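/- Let $\mathbb{H}=\{z\in\mathbb{C}:\Im z>0\}$, and let $\overline{\mathbb{H}}=\mathbb{H}\cup\mathbb{R}\cup\{\infty\}$ be its closure in the Riemann sphere $\mathbb{C}\cup\{\infty\}$. Suppose that $\psi_1,\psi_2:\mathbb{H}\to\mathbb{H}$ are two analytic functions such that \[ \lim_{y\uparrow\infty}\frac{\psi_j(iy)}{iy}=0,\qquad j=1,2. \] Then there exist continuous functions $\omega_1,\omega_2:\mathbb{H}\cup\mathbb{R}\to\overline{\mathbb{H}}$ that are finite and analytic on $\mathbb{H}$, with $\omega_j(\mathbb{H})\subseteq\mathbb{H}$ for $j=1,2$, and \[ \omega_1(z)+\psi_1(\omega_1(z))=\omega_2(z)+\psi_2(\omega_2(z))=\omega_1(z)+\omega_2(z)-z,\qquad z\in\mathbb{H}. \] -/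

import Mathlib

open Complex Filter Topology Set
open UpperHalfPlane (upperHalfPlaneSet)

/-- The set `ℍ ∪ ℝ` as a subset of `ℂ`. -/
def closedHalfPlane : Set ℂ := {z : ℂ | 0 ≤ z.im}

/-- The set `ℍ ∪ ℝ ∪ {∞}` as a subset of the Riemann sphere `OnePoint ℂ`, which carries the
topology of the one-point compactification of `ℂ`. -/
def sphereHalfPlane : Set (OnePoint ℂ) :=
  insert OnePoint.infty ((fun w : ℂ => (w : OnePoint ℂ)) '' closedHalfPlane)

/-!
For `z` in the upper half-plane, the requested identities say that `ω₁(z)` is a fixed point of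
`subordMap ψ₁ ψ₂ z : w ↦ z + ψ₂ (z + ψ₁ w)` and that `ω₂(z) = z + ψ₁ (ω₁ z)`, which is a fixed point
of the map with `ψ₁` and `ψ₂` exchanged. Everything rests on the Schwarz–Pick inequality, written
for the gap `|z - w|² / (Im z · Im w)` (`hypGap_map_le`), and on its equality case
(`exists_cayley_map_eq`).

*Interior.* `subordMap ψ₁ ψ₂ z` pushes the half-plane up by `Im z > 0`, so it strictly decreases
gaps; hence the fixed point is unique and the derivative there is not `1`, and analyticity in `z`
follows from the implicit function theorem (`differentiableOn_of_fixed`). For existence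
(`exists_fixed_subordMap`), an orbit that does not escape to infinity accumulates at a fixed point,
while an escaping orbit would give, by Julia's lemma, `Im (z + ψ₁ w) ≥ k Im w` for some `k > 0`,
which the growth condition on `ψ₁` forbids.

*Boundary.* At a real point `x` it is enough that `ω₁` has finitely many cluster values in the
sphere, because the cluster set is connected (`exists_tendsto_of_finite_mapClusterPt`). A cluster
value in the half-plane is a fixed point of `subordMap ψ₁ ψ₂ x`; a real cluster value is a point
whose horodiscs that map preserves (`horodisc_of_tendsto`). Two cluster values of the same kind
force the map to be the identity, so there are at most three values, infinity included, unless
`subordMap ψ₁ ψ₂ x` is the identity. In that case `x + ψ₁` is a Möbius transformation and the finite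
cluster values are roots of an explicit quadratic (`exists_quadratic_of_eqOn_id`).
-/

open scoped ComplexConjugate

/-! ### The Schwarz–Pick inequality in the upper half-plane -/

/-- The hyperbolic gap `|z - w|² / (Im z · Im w)` of two points of the upper half-plane. It equals
`2 (cosh d - 1)`, where `d` is their hyperbolic distance. -/
noncomputable def hypGap (z w : ℂ) : ℝ := normSq (z - w) / (z.im * w.im)

/-- The Cayley transform of the upper half-plane onto the unit disc that sends `p` to `0`. -/
noncomputable def cayley (p u : ℂ) : ℂ := (u - p) / (u - conj p)

/-- The inverse of `cayley p`. -/
noncomputable def cayleyInv (p ζ : ℂ) : ℂ := (p - conj p * ζ) / (1 - ζ)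

lemma mem_upperHalfPlaneSet_iff {z : ℂ} : z ∈ upperHalfPlaneSet ↔ 0 < z.im := Iff.rfl

lemma normSq_sub_conj (u p : ℂ) : normSq (u - conj p) = normSq (u - p) + 4 * (u.im * p.im) := by
  simp [normSq_apply]; ring

lemma sub_conj_ne_zero {u p : ℂ} (hu : 0 < u.im) (hp : 0 < p.im) : u - conj p ≠ 0 := by
  intro h
  have := congrArg im h
  simp at this
  linarith

lemma hypGap_nonneg {z w : ℂ} (hz : 0 < z.im) (hw : 0 < w.im) : 0 ≤ hypGap z w :=
  div_nonneg (normSq_nonneg _) (mul_pos hz hw).le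

lemma hypGap_pos {z w : ℂ} (hz : 0 < z.im) (hw : 0 < w.im) (h : z ≠ w) : 0 < hypGap z w :=
  div_pos (normSq_pos.2 (sub_ne_zero.2 h)) (mul_pos hz hw)

lemma normSq_cayley {u p : ℂ} (hu : 0 < u.im) (hp : 0 < p.im) :
    normSq (cayley p u) = 1 - 4 / (hypGap u p + 4) := by
  have h1 := normSq_nonneg (u - p)
  have h2 := mul_pos hu hp
  rw [cayley, normSq_div, normSq_sub_conj, hypGap]
  have : normSq (u - p) + 4 * (u.im * p.im) ≠ 0 := by positivity
  field_simp
  ring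

lemma norm_cayley_lt_one {u p : ℂ} (hu : 0 < u.im) (hp : 0 < p.im) : ‖cayley p u‖ < 1 := by
  have h : normSq (cayley p u) < 1 := by
    have := hypGap_nonneg hu hp
    rw [normSq_cayley hu hp, sub_lt_self_iff]
    positivity
  rw [normSq_eq_norm_sq] at h
  exact (sq_lt_one_iff₀ (norm_nonneg _)).1 h

lemma norm_cayley_le_iff {u p v q : ℂ} (hu : 0 < u.im) (hp : 0 < p.im) (hv : 0 < v.im)
    (hq : 0 < q.im) : ‖cayley p u‖ ≤ ‖cayley q v‖ ↔ hypGap u p ≤ hypGap v q := by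
  rw [← sq_le_sq₀ (norm_nonneg _) (norm_nonneg _), ← normSq_eq_norm_sq, ← normSq_eq_norm_sq,
    normSq_cayley hu hp, normSq_cayley hv hq, sub_le_sub_iff_left]
  have := hypGap_nonneg hu hp
  have := hypGap_nonneg hv hq
  rw [div_le_div_iff_of_pos_left (by norm_num) (by linarith) (by linarith)]
  exact add_le_add_iff_right 4

lemma cayleyInv_cayley {u p : ℂ} (hu : 0 < u.im) (hp : 0 < p.im) :
    cayleyInv p (cayley p u) = u := by
  have h1 := sub_conj_ne_zero hu hp
  have h2 := sub_conj_ne_zero hp hp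
  unfold cayleyInv cayley
  have h3 : 1 - (u - p) / (u - conj p) = (p - conj p) / (u - conj p) := by
    field_simp; ring
  rw [h3]
  field_simp
  ring

lemma cayley_injOn {p : ℂ} (hp : 0 < p.im) : InjOn (cayley p) upperHalfPlaneSet := by
  intro u hu v hv h
  rw [← cayleyInv_cayley hu hp, h, cayleyInv_cayley hv hp]

lemma one_sub_ne_zero_of_norm_lt {ζ : ℂ} (h : ‖ζ‖ < 1) : 1 - ζ ≠ 0 := by
  intro h0
  rw [sub_eq_zero] at h0
  simp [← h0] at h

lemma cayleyInv_im_pos {p ζ : ℂ} (hp : 0 < p.im) (h : ‖ζ‖ < 1) : 0 < (cayleyInv p ζ).im := by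
  have h1 := normSq_pos.2 (one_sub_ne_zero_of_norm_lt h)
  have h2 : normSq ζ < 1 := by
    rw [normSq_eq_norm_sq]; exact (sq_lt_one_iff₀ (norm_nonneg _)).2 h
  have : (cayleyInv p ζ).im = p.im * (1 - normSq ζ) / normSq (1 - ζ) := by
    rw [cayleyInv, div_im]
    simp only [normSq_apply]
    simp
    ring
  rw [this]
  exact div_pos (mul_pos hp (by linarith)) h1

lemma cayleyInv_zero (p : ℂ) : cayleyInv p 0 = p := by simp [cayleyInv]

lemma cayley_self (p : ℂ) : cayley p p = 0 := by simp [cayley]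

section SchwarzPick

variable {f : ℂ → ℂ} {p u : ℂ}

lemma differentiableOn_discModel (hf : DifferentiableOn ℂ f upperHalfPlaneSet)
    (hm : MapsTo f upperHalfPlaneSet upperHalfPlaneSet) (hp : 0 < p.im) :
    DifferentiableOn ℂ (fun ζ => cayley (f p) (f (cayleyInv p ζ))) (Metric.ball 0 1) := by
  have h1 : DifferentiableOn ℂ (cayleyInv p) (Metric.ball 0 1) := by
    unfold cayleyInv
    refine DifferentiableOn.div (by fun_prop) (by fun_prop) fun ζ hζ => ?_
    exact one_sub_ne_zero_of_norm_lt (by simpa using hζ)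
  have h2 : MapsTo (cayleyInv p) (Metric.ball 0 1) upperHalfPlaneSet := fun ζ hζ =>
    cayleyInv_im_pos hp (by simpa using hζ)
  have h3 := hf.comp h1 h2
  unfold cayley
  exact (h3.sub_const _).div (h3.sub_const _) fun ζ hζ => sub_conj_ne_zero (hm (h2 hζ)) (hm hp)

lemma mapsTo_discModel (hm : MapsTo f upperHalfPlaneSet upperHalfPlaneSet) (hp : 0 < p.im) :
    MapsTo (fun ζ => cayley (f p) (f (cayleyInv p ζ))) (Metric.ball 0 1) (Metric.ball 0 1) := by
  intro ζ hζ
  have := norm_cayley_lt_one (hm (cayleyInv_im_pos hp (ζ := ζ) (by simpa using hζ))) (hm hp)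
  simpa using this

/-- The **Schwarz–Pick inequality**: analytic self-maps of the upper half-plane do not increase
the hyperbolic gap. -/
theorem hypGap_map_le (hf : DifferentiableOn ℂ f upperHalfPlaneSet)
    (hm : MapsTo f upperHalfPlaneSet upperHalfPlaneSet) (hp : 0 < p.im) (hu : 0 < u.im) :
    hypGap (f u) (f p) ≤ hypGap u p := by
  rw [← norm_cayley_le_iff (hm hu) (hm hp) hu hp]
  have := norm_le_norm_of_mapsTo_ball (differentiableOn_discModel hf hm hp)
    ((mapsTo_discModel hm hp).mono_right Metric.ball_subset_closedBall)
    (by simp [cayleyInv_zero, cayley_self]) (norm_cayley_lt_one hu hp)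
  simpa [cayleyInv_cayley hu hp] using this

/-- The equality case of the Schwarz–Pick inequality: one pair of distinct points whose gap is
preserved forces the map to be a rotation in Cayley coordinates. -/
theorem exists_cayley_map_eq (hf : DifferentiableOn ℂ f upperHalfPlaneSet)
    (hm : MapsTo f upperHalfPlaneSet upperHalfPlaneSet) (hp : 0 < p.im) (hu : 0 < u.im)
    (hne : u ≠ p) (heq : hypGap u p ≤ hypGap (f u) (f p)) :
    ∃ κ : ℂ, κ ≠ 0 ∧ ‖κ‖ = 1 ∧
      ∀ v ∈ upperHalfPlaneSet, cayley (f p) (f v) = κ * cayley p v := by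
  set g := fun ζ => cayley (f p) (f (cayleyInv p ζ)) with hg
  have hg0 : g 0 = 0 := by simp [hg, cayleyInv_zero, cayley_self]
  have h1 : ‖cayley p u‖ = ‖cayley (f p) (f u)‖ :=
    le_antisymm ((norm_cayley_le_iff hu hp (hm hu) (hm hp)).2 heq)
      ((norm_cayley_le_iff (hm hu) (hm hp) hu hp).2 (hypGap_map_le hf hm hp hu))
  have h2 : cayley p u ≠ 0 := by
    rw [← cayley_self p]
    exact fun h => hne (cayley_injOn hp hu hp h)
  have hball : cayley p u ∈ Metric.ball (0 : ℂ) 1 := by simpa using norm_cayley_lt_one hu hp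
  obtain ⟨κ, hκ, hE⟩ := affine_of_mapsTo_ball_of_exists_norm_dslope_eq_div' (R₂ := 1)
    (differentiableOn_discModel hf hm hp) (by
      rw [show cayley (f p) (f (cayleyInv p 0)) = 0 from hg0]
      exact (mapsTo_discModel hm hp).mono_right Metric.ball_subset_closedBall)
    ⟨_, hball, by
      rw [dslope_of_ne _ h2, slope_def_field, show cayley (f p) (f (cayleyInv p 0)) = 0 from hg0,
        cayleyInv_cayley hu hp, sub_zero, sub_zero, norm_div, ← h1,
        div_self (norm_ne_zero_iff.2 h2), div_one]⟩
  have hκ' : ‖κ‖ = 1 := by simpa using hκ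
  refine ⟨κ, fun h => by simp [h] at hκ', hκ', fun v hv => ?_⟩
  have := hE (x := cayley p v) (by simpa using norm_cayley_lt_one hv hp)
  simpa [cayleyInv_cayley hv hp, cayleyInv_zero, cayley_self, mul_comm] using this

/-- An analytic self-map of the upper half-plane with two fixed points is the identity. -/
theorem eqOn_id_of_two_fixed (hf : DifferentiableOn ℂ f upperHalfPlaneSet)
    (hm : MapsTo f upperHalfPlaneSet upperHalfPlaneSet) (hp : 0 < p.im) (hu : 0 < u.im)
    (hne : u ≠ p) (hfp : f p = p) (hfu : f u = u) : EqOn f id upperHalfPlaneSet := by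
  obtain ⟨κ, -, -, hκ⟩ := exists_cayley_map_eq hf hm hp hu hne (by rw [hfp, hfu])
  have h1 : κ = 1 := by
    have h2 := hκ u hu
    rw [hfp, hfu] at h2
    refine (mul_eq_right₀ ?_).1 h2.symm
    rw [← cayley_self p]
    exact fun h => hne (cayley_injOn hp hu hp h)
  intro v hv
  have := hκ v hv
  rw [h1, one_mul, hfp] at this
  exact cayley_injOn hp (hm hv) hv this

/-- A map that pushes the half-plane up by `c > 0` strictly decreases the hyperbolic gap of
distinct points. -/
theorem hypGap_map_lt (hf : DifferentiableOn ℂ f upperHalfPlaneSet) {c : ℝ} (hc : 0 < c)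
    (hm : ∀ w ∈ upperHalfPlaneSet, c < (f w).im) (hp : 0 < p.im) (hu : 0 < u.im) (hne : u ≠ p) :
    hypGap (f u) (f p) < hypGap u p := by
  by_cases hfe : f u = f p
  · rw [hfe]
    simpa [hypGap] using hypGap_pos hu hp hne
  have h := hypGap_map_le (f := fun w => f w - c * I) (hf.sub_const _)
    (fun w hw => by simpa [mem_upperHalfPlaneSet_iff] using hm w hw) hp hu
  refine lt_of_lt_of_le ?_ h
  have h1 := hm u hu
  have h2 := hm p hp
  simp only [hypGap, sub_sub_sub_cancel_right]
  simp only [sub_im, mul_im, ofReal_re, I_im, mul_one, ofReal_im, I_re, mul_zero, add_zero]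
  refine div_lt_div_of_pos_left (normSq_pos.2 (sub_ne_zero.2 hfe))
    (mul_pos (by linarith) (by linarith)) (mul_lt_mul'' ?_ ?_ ?_ ?_) <;> linarith

end SchwarzPick

/-! ### Interior fixed points -/

lemma tendsto_hypGap {ι : Type*} {l : Filter ι} {u v : ι → ℂ} {a b : ℂ} (hu : Tendsto u l (𝓝 a))
    (hv : Tendsto v l (𝓝 b)) (ha : 0 < a.im) (hb : 0 < b.im) :
    Tendsto (fun i => hypGap (u i) (v i)) l (𝓝 (hypGap a b)) := by
  unfold hypGap
  exact ((continuous_normSq.tendsto _).comp (hu.sub hv)).div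
    (((continuous_im.tendsto _).comp hu).mul ((continuous_im.tendsto _).comp hv))
    (mul_pos ha hb).ne'

/-- If `f` pushes the half-plane up by `c > 0` and some orbit of `f` does not escape to infinity,
then `f` has a fixed point: the hyperbolic gap of consecutive orbit points is nonincreasing, hence
constant along the orbit of an accumulation point, which strict contraction permits only at a
fixed point. -/
theorem exists_fixed_of_orbit_not_escaping {f : ℂ → ℂ} {c : ℝ} {w : ℕ → ℂ}
    (hf : DifferentiableOn ℂ f upperHalfPlaneSet) (hc : 0 < c)
    (hm : ∀ w ∈ upperHalfPlaneSet, c < (f w).im) (hw : ∀ n, c ≤ (w n).im)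
    (hstep : ∀ n, w (n + 1) = f (w n)) (hesc : ¬ Tendsto w atTop (Bornology.cobounded ℂ)) :
    ∃ a ∈ upperHalfPlaneSet, f a = a := by
  have hmaps : MapsTo f upperHalfPlaneSet upperHalfPlaneSet := fun u hu => hc.trans (hm u hu)
  have hwpos : ∀ n, 0 < (w n).im := fun n => hc.trans_le (hw n)
  have hfreq : ∃ R : ℝ, ∃ᶠ n in atTop, w n ∈ Metric.closedBall (0 : ℂ) R ∩ {u | c ≤ u.im} := by
    rw [← tendsto_norm_atTop_iff_cobounded, tendsto_atTop] at hesc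
    push Not at hesc
    obtain ⟨R, hR⟩ := hesc
    refine ⟨R, hR.mono fun n hn => ⟨?_, hw n⟩⟩
    simpa using hn.le
  obtain ⟨R, hR⟩ := hfreq
  have hK : IsCompact (Metric.closedBall (0 : ℂ) R ∩ {u | c ≤ u.im}) :=
    (isCompact_closedBall 0 R).inter_right (isClosed_le continuous_const continuous_im)
  obtain ⟨a, ha, σ, hσ, hlim⟩ := hK.tendsto_subseq' hR
  have ha0 : 0 < a.im := hc.trans_le ha.2
  have hcont : ∀ u, 0 < u.im → ContinuousAt f u := fun u hu =>
    (hf.differentiableAt (UpperHalfPlane.isOpen_upperHalfPlaneSet.mem_nhds hu)).continuousAt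
  have hanti : Antitone fun n => hypGap (w (n + 1)) (w n) := antitone_nat_of_succ_le fun n => by
    have := hypGap_map_le hf hmaps (hwpos n) (hwpos (n + 1))
    rwa [← hstep, ← hstep] at this
  obtain ⟨ℓ, hℓ⟩ : ∃ ℓ, Tendsto (fun n => hypGap (w (n + 1)) (w n)) atTop (𝓝 ℓ) :=
    ⟨_, tendsto_atTop_ciInf hanti
      ⟨0, by rintro _ ⟨n, rfl⟩; exact hypGap_nonneg (hwpos _) (hwpos _)⟩⟩
  have h1 : Tendsto (fun k => w (σ k + 1)) atTop (𝓝 (f a)) := by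
    simp only [hstep]
    exact (hcont a ha0).tendsto.comp hlim
  have h2 : Tendsto (fun k => w (σ k + 1 + 1)) atTop (𝓝 (f (f a))) := by
    simp only [hstep _]
    exact (hcont _ (hmaps ha0)).tendsto.comp ((hcont a ha0).tendsto.comp hlim)
  have e1 := tendsto_nhds_unique (tendsto_hypGap h1 hlim (hmaps ha0) ha0)
    (hℓ.comp hσ.tendsto_atTop)
  have e2 := tendsto_nhds_unique (tendsto_hypGap h2 h1 (hmaps (hmaps ha0)) (hmaps ha0))
    (hℓ.comp ((tendsto_add_atTop_nat 1).comp hσ.tendsto_atTop))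
  refine ⟨a, ha0, by_contra fun hne => ?_⟩
  have := hypGap_map_lt hf hc hm ha0 (hmaps ha0) hne
  rw [e1, e2] at this
  exact lt_irrefl _ this

lemma tendsto_normSq_sub_div {ι : Type*} {l : Filter ι} {w : ι → ℂ} (u : ℂ)
    (hw : Tendsto w l (Bornology.cobounded ℂ)) :
    Tendsto (fun i => normSq (u - w i) / normSq (w i)) l (𝓝 1) := by
  have h1 : Tendsto (fun i => normSq (u * (w i)⁻¹ - 1)) l (𝓝 1) := by
    have h2 : Tendsto (fun i => u * (w i)⁻¹ - 1) l (𝓝 (u * 0 - 1)) :=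
      ((tendsto_inv₀_cobounded.comp hw).const_mul u).sub_const 1
    simpa [Function.comp_def] using (continuous_normSq.tendsto _).comp h2
  refine h1.congr' ?_
  filter_upwards [hw.eventually (Bornology.eventually_ne_cobounded 0)] with i hi
  rw [← normSq_div]
  congr 1
  field_simp

/-- The horocyclic size `|w|² / Im w`: its sublevel sets are the horodiscs at the boundary
point `0`. -/
noncomputable def horoSize (w : ℂ) : ℝ := normSq w / w.im

lemma norm_le_horoSize {w : ℂ} (hw : 0 < w.im) : ‖w‖ ≤ horoSize w := by
  have h0 : 0 < ‖w‖ := hw.trans_le (im_le_norm w)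
  rw [horoSize, normSq_eq_norm_sq, le_div_iff₀ hw]
  nlinarith [im_le_norm w]

/-- A form of **Julia's lemma** at infinity: if `w i → ∞`, `φ (w i) → ∞`, and the horocyclic size
of `φ (w i)` is at least `k` times that of `w i`, then `Im φ ≥ k Im`. -/
theorem julia_at_infinity {φ : ℂ → ℂ} (hφ : DifferentiableOn ℂ φ upperHalfPlaneSet)
    (hm : MapsTo φ upperHalfPlaneSet upperHalfPlaneSet) {ι : Type*} {l : Filter ι} [l.NeBot]
    {w : ι → ℂ} (hw : ∀ i, 0 < (w i).im) (hlim : Tendsto w l (Bornology.cobounded ℂ))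
    (hlim' : Tendsto (fun i => φ (w i)) l (Bornology.cobounded ℂ)) {k : ℝ}
    (hk : ∀ i, k * horoSize (w i) ≤ horoSize (φ (w i))) {u : ℂ} (hu : 0 < u.im) :
    k * u.im ≤ (φ u).im := by
  have hφu : 0 < (φ u).im := hm hu
  have hle : ∀ i, k * (normSq (φ u - φ (w i)) / normSq (φ (w i)) / (φ u).im) ≤
      normSq (u - w i) / normSq (w i) / u.im := by
    intro i
    have h0 : 0 < (φ (w i)).im := hm (hw i)
    have hN : 0 < normSq (w i) := normSq_pos.2 fun h => by simpa [h] using hw i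
    have hN' : 0 < normSq (φ (w i)) := normSq_pos.2 fun h => by simp [h] at h0
    have hE : 0 < horoSize (w i) := div_pos hN (hw i)
    have h1 := hypGap_map_le hφ hm (hw i) hu
    have e1 : hypGap (φ u) (φ (w i)) =
        horoSize (φ (w i)) * (normSq (φ u - φ (w i)) / normSq (φ (w i)) / (φ u).im) := by
      unfold hypGap horoSize
      field_simp
    have e2 : hypGap u (w i) = horoSize (w i) * (normSq (u - w i) / normSq (w i) / u.im) := by
      unfold hypGap horoSize
      have := hw i
      field_simp
    rw [e1, e2] at h1
    set A := normSq (φ u - φ (w i)) / normSq (φ (w i)) / (φ u).im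
    have hA : 0 ≤ A := div_nonneg (div_nonneg (normSq_nonneg _) hN'.le) hφu.le
    refine le_of_mul_le_mul_left ?_ hE
    calc horoSize (w i) * (k * A) = k * horoSize (w i) * A := by ring
      _ ≤ horoSize (φ (w i)) * A := mul_le_mul_of_nonneg_right (hk i) hA
      _ ≤ _ := h1
  have hfin := le_of_tendsto_of_tendsto'
    (((tendsto_normSq_sub_div (φ u) hlim').div_const _).const_mul k)
    ((tendsto_normSq_sub_div u hlim).div_const _) hle
  rw [mul_one_div, div_le_div_iff₀ hφu hu, one_mul] at hfin
  exact hfin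

/-- On a half-plane `Im ≥ c`, an analytic self-map of the upper half-plane increases the horocyclic
size by at most a constant factor at points with large image. This is the Schwarz–Pick inequality
against the base point `I`, whose gap from a far point `a` is comparable to `horoSize a`. -/
lemma exists_mul_horoSize_map_le {φ : ℂ → ℂ} (hφ : DifferentiableOn ℂ φ upperHalfPlaneSet)
    (hm : MapsTo φ upperHalfPlaneSet upperHalfPlaneSet) {c : ℝ} (hc : 0 < c) :
    ∃ k > 0, ∃ R, ∀ a, c ≤ a.im → R ≤ ‖φ a‖ → k * horoSize (φ a) ≤ horoSize a := by
  have hI : (0 : ℝ) < (I : ℂ).im := by simp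
  set m := (φ I).im with hmdef
  have hm0 : 0 < m := hm hI
  refine ⟨1 / (16 * m), by positivity, max (2 * ‖φ I‖) (16 * m / c), fun a ha hR => ?_⟩
  have ha0 : 0 < a.im := hc.trans_le ha
  have hb0 : 0 < (φ a).im := hm ha0
  have h1 := hypGap_map_le hφ hm hI ha0
  have hR1 : 2 * ‖φ I‖ ≤ ‖φ a‖ := (le_max_left _ _).trans hR
  have hR2 : 16 * m / c ≤ horoSize (φ a) :=
    ((le_max_right _ _).trans hR).trans (norm_le_horoSize hb0)
  -- the left side of the Schwarz–Pick inequality dominates `horoSize (φ a) / (4 m)`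
  have h2 : horoSize (φ a) / (4 * m) ≤ hypGap (φ a) (φ I) := by
    have h3 : ‖φ a‖ / 2 ≤ ‖φ a - φ I‖ := by
      have := norm_sub_norm_le (φ a) (φ I)
      linarith
    have h4 : normSq (φ a) ≤ 4 * normSq (φ a - φ I) := by
      rw [normSq_eq_norm_sq, normSq_eq_norm_sq]
      nlinarith [norm_nonneg (φ a)]
    rw [horoSize, hypGap, ← hmdef, div_div, div_le_div_iff₀ (by positivity) (by positivity)]
    nlinarith [mul_pos hb0 hm0]
  -- the right side is at most `2 horoSize a + 2 / c`
  have h5 : hypGap a I ≤ 2 * horoSize a + 2 / c := by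
    have h6 : normSq (a - I) ≤ 2 * normSq a + 2 := by
      simp only [normSq_apply]
      simp
      nlinarith [sq_nonneg (a.im + 1), sq_nonneg a.re]
    have h7 : 2 / a.im ≤ 2 / c := div_le_div_of_nonneg_left (by norm_num) hc ha
    have h8 : hypGap a I ≤ (2 * normSq a + 2) / a.im := by
      rw [hypGap, I_im, mul_one]
      exact div_le_div_of_nonneg_right h6 ha0.le
    rw [add_div, mul_div_assoc] at h8
    exact h8.trans (by unfold horoSize; linarith)
  have h9 : 2 / c ≤ horoSize (φ a) / (8 * m) := by
    rw [le_div_iff₀ (by positivity)]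
    refine le_trans (le_of_eq ?_) hR2
    ring
  have h10 : horoSize (φ a) / (4 * m) = 4 * (1 / (16 * m) * horoSize (φ a)) := by
    field_simp; norm_num
  have h11 : horoSize (φ a) / (8 * m) = 2 * (1 / (16 * m) * horoSize (φ a)) := by
    field_simp; ring
  linarith

lemma frequently_le_succ_of_tendsto_atTop {E : ℕ → ℝ} (h : Tendsto E atTop atTop) :
    ∃ᶠ n in atTop, E n ≤ E (n + 1) := by
  intro hcon
  obtain ⟨N, hN⟩ := eventually_atTop.1 hcon
  have hb : ∀ n ≥ N, E n ≤ E N := by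
    intro n hn
    induction n, hn using Nat.le_induction with
    | base => exact le_rfl
    | succ n hn ih => exact (not_le.1 (hN n hn)).le.trans ih
  obtain ⟨n, hn1, hn2⟩ := ((h.eventually_gt_atTop (E N)).and (eventually_ge_atTop N)).exists
  exact (hb n hn2).not_gt hn1

/-- The map `w ↦ z + ψ₂ (z + ψ₁ w)`, whose fixed point is the value at `z` of the first
subordination function. -/
def subordMap (ψ₁ ψ₂ : ℂ → ℂ) (z w : ℂ) : ℂ := z + ψ₂ (z + ψ₁ w)

section Subord

variable {ψ₁ ψ₂ : ℂ → ℂ} {z : ℂ}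

lemma mapsTo_const_add (hm : MapsTo ψ₁ upperHalfPlaneSet upperHalfPlaneSet) (hz : 0 ≤ z.im) :
    MapsTo (fun w => z + ψ₁ w) upperHalfPlaneSet upperHalfPlaneSet := fun w hw => by
  have : 0 < (ψ₁ w).im := hm hw
  rw [mem_upperHalfPlaneSet_iff, add_im]
  linarith

lemma lt_subordMap_im (hm₁ : MapsTo ψ₁ upperHalfPlaneSet upperHalfPlaneSet)
    (hm₂ : MapsTo ψ₂ upperHalfPlaneSet upperHalfPlaneSet) (hz : 0 ≤ z.im) {w : ℂ}
    (hw : w ∈ upperHalfPlaneSet) : z.im < (subordMap ψ₁ ψ₂ z w).im := by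
  have : 0 < (ψ₂ (z + ψ₁ w)).im := hm₂ (mapsTo_const_add hm₁ hz hw)
  rw [subordMap, add_im]
  linarith

lemma mapsTo_subordMap (hm₁ : MapsTo ψ₁ upperHalfPlaneSet upperHalfPlaneSet)
    (hm₂ : MapsTo ψ₂ upperHalfPlaneSet upperHalfPlaneSet) (hz : 0 ≤ z.im) :
    MapsTo (subordMap ψ₁ ψ₂ z) upperHalfPlaneSet upperHalfPlaneSet := fun _ hw =>
  hz.trans_lt (lt_subordMap_im hm₁ hm₂ hz hw)

lemma differentiableOn_subordMap (hψ₁ : DifferentiableOn ℂ ψ₁ upperHalfPlaneSet)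
    (hψ₂ : DifferentiableOn ℂ ψ₂ upperHalfPlaneSet)
    (hm₁ : MapsTo ψ₁ upperHalfPlaneSet upperHalfPlaneSet) (hz : 0 ≤ z.im) :
    DifferentiableOn ℂ (subordMap ψ₁ ψ₂ z) upperHalfPlaneSet :=
  (hψ₂.comp (hψ₁.const_add z) (mapsTo_const_add hm₁ hz)).const_add z

/-- If the orbit of a point escaped to infinity, then `z + ψ₁` would satisfy
`Im (z + ψ₁ w) ≥ k Im w` with some `k > 0` by Julia's lemma, against `ψ₁ (i y) = o(y)`. -/
theorem exists_fixed_subordMap (hψ₁ : DifferentiableOn ℂ ψ₁ upperHalfPlaneSet)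
    (hψ₂ : DifferentiableOn ℂ ψ₂ upperHalfPlaneSet)
    (hm₁ : MapsTo ψ₁ upperHalfPlaneSet upperHalfPlaneSet)
    (hm₂ : MapsTo ψ₂ upperHalfPlaneSet upperHalfPlaneSet)
    (hlim₁ : Tendsto (fun y : ℝ => ψ₁ ((y : ℂ) * I) / ((y : ℂ) * I)) atTop (𝓝 0))
    (hz : 0 < z.im) : ∃ w ∈ upperHalfPlaneSet, subordMap ψ₁ ψ₂ z w = w := by
  set f := subordMap ψ₁ ψ₂ z with hf
  set φ : ℂ → ℂ := fun w => z + ψ₁ w with hφ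
  set w : ℕ → ℂ := fun n => f^[n] z with hw
  have hstep : ∀ n, w (n + 1) = f (w n) := fun n => Function.iterate_succ_apply' f n z
  have hlow : ∀ n, z.im ≤ (w n).im := by
    intro n
    induction n with
    | zero => exact le_rfl
    | succ n ih =>
      rw [hstep]
      exact (lt_subordMap_im hm₁ hm₂ hz.le (hz.trans_le ih)).le
  have hpos : ∀ n, 0 < (w n).im := fun n => hz.trans_le (hlow n)
  refine exists_fixed_of_orbit_not_escaping (differentiableOn_subordMap hψ₁ hψ₂ hm₁ hz.le) hz
    (fun u hu => lt_subordMap_im hm₁ hm₂ hz.le hu) hlow hstep fun hesc => ?_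
  have hφm := mapsTo_const_add (z := z) hm₁ hz.le
  have hφim : ∀ u, 0 < u.im → z.im ≤ (φ u).im := fun u hu => by
    have : 0 < (ψ₁ u).im := hm₁ hu
    simp only [hφ, add_im]
    linarith
  have hEtop : Tendsto (fun n => horoSize (w n)) atTop atTop :=
    tendsto_atTop_mono (fun n => norm_le_horoSize (hpos n))
      (tendsto_norm_cobounded_atTop.comp hesc)
  obtain ⟨k, hk, R, hkR⟩ := exists_mul_horoSize_map_le (hψ₂.const_add z)
    (mapsTo_const_add hm₂ hz.le) hz
  have hgood : ∃ᶠ n in atTop, k * horoSize (w n) ≤ horoSize (φ (w n)) := by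
    have hR : ∀ᶠ n in atTop, R ≤ ‖w (n + 1)‖ :=
      ((tendsto_norm_cobounded_atTop.comp hesc).comp (tendsto_add_atTop_nat 1)).eventually_ge_atTop R
    refine ((frequently_le_succ_of_tendsto_atTop hEtop).and_eventually hR).mono fun n hn => ?_
    rw [hstep] at hn
    exact (mul_le_mul_of_nonneg_left hn.1 hk.le).trans (hkR _ (hφim _ (hpos n)) hn.2)
  obtain ⟨σ, hσ, hσk⟩ := extraction_of_frequently_atTop hgood
  have hlim := hesc.comp hσ.tendsto_atTop
  have hlim' : Tendsto (fun i => φ (w (σ i))) atTop (Bornology.cobounded ℂ) := by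
    rw [← tendsto_norm_atTop_iff_cobounded]
    have hE : Tendsto (fun i => horoSize (φ (w (σ i)))) atTop atTop :=
      tendsto_atTop_mono hσk ((hEtop.comp hσ.tendsto_atTop).const_mul_atTop hk)
    refine tendsto_atTop.2 fun b => ?_
    filter_upwards [hE.eventually_ge_atTop ((|b| ^ 2 + 1) / z.im)] with i hi
    have h1 := hφim _ (hpos (σ i))
    have h2 : horoSize (φ (w (σ i))) ≤ ‖φ (w (σ i))‖ ^ 2 / z.im := by
      rw [horoSize, normSq_eq_norm_sq]
      exact div_le_div_of_nonneg_left (by positivity) hz h1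
    have h3 := (div_le_div_iff_of_pos_right hz).1 (hi.trans h2)
    exact (le_abs_self b).trans (abs_le_of_sq_le_sq (by linarith [sq_abs b]) (norm_nonneg _))
  have hjulia : ∀ y : ℝ, 0 < y → k * y ≤ z.im + (ψ₁ (y * I)).im := fun y hy => by
    have := julia_at_infinity (hψ₁.const_add z) hφm (fun i => hpos (σ i)) hlim hlim' hσk
      (u := y * I) (by simpa using hy)
    simpa using this
  have hre : Tendsto (fun y : ℝ => z.im / y + (ψ₁ ((y : ℂ) * I) / ((y : ℂ) * I)).re) atTop
      (𝓝 (0 + 0)) :=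
    (tendsto_const_nhds.div_atTop tendsto_id).add ((continuous_re.tendsto _).comp hlim₁)
  have hcon : k ≤ 0 + 0 := by
    refine ge_of_tendsto hre ?_
    filter_upwards [eventually_gt_atTop 0] with y hy
    have h1 := hjulia y hy
    have h2 : (ψ₁ ((y : ℂ) * I) / ((y : ℂ) * I)).re = (ψ₁ (y * I)).im / y := by
      simp [div_re, normSq_apply]
      field_simp
    rw [h2, ← add_div, le_div_iff₀ hy]
    exact h1
  linarith

/-- The fixed point is unique because `subordMap ψ₁ ψ₂ z` pushes the half-plane up by `Im z`. -/
theorem fixed_subordMap_unique (hψ₁ : DifferentiableOn ℂ ψ₁ upperHalfPlaneSet)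
    (hψ₂ : DifferentiableOn ℂ ψ₂ upperHalfPlaneSet)
    (hm₁ : MapsTo ψ₁ upperHalfPlaneSet upperHalfPlaneSet)
    (hm₂ : MapsTo ψ₂ upperHalfPlaneSet upperHalfPlaneSet) (hz : 0 < z.im) {u v : ℂ}
    (hu : 0 < u.im) (hv : 0 < v.im) (hfu : subordMap ψ₁ ψ₂ z u = u)
    (hfv : subordMap ψ₁ ψ₂ z v = v) : u = v := by
  by_contra hne
  have := hypGap_map_lt (differentiableOn_subordMap hψ₁ hψ₂ hm₁ hz.le) hz
    (fun w hw => lt_subordMap_im hm₁ hm₂ hz.le hw) hv hu hne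
  rw [hfu, hfv] at this
  exact lt_irrefl _ this

end Subord

/-! ### Analytic dependence of the fixed point -/

/-- The infinitesimal form of the strict contraction at a fixed point. -/
lemma deriv_ne_one_of_fixed {f : ℂ → ℂ} {c : ℝ} {p : ℂ}
    (hf : DifferentiableOn ℂ f upperHalfPlaneSet) (hc : 0 < c)
    (hm : ∀ w ∈ upperHalfPlaneSet, c < (f w).im) (hp : 0 < p.im) (hfp : f p = p) :
    deriv f p ≠ 1 := by
  intro hd
  have hH : upperHalfPlaneSet ∈ 𝓝 p := UpperHalfPlane.isOpen_upperHalfPlaneSet.mem_nhds hp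
  have hda := hf.differentiableAt hH
  have hpc : c < p.im := by simpa [hfp] using hm p hp
  have hslope : Tendsto (fun u => normSq (slope f p u)) (𝓝[≠] p) (𝓝 1) := by
    have h1 := hasDerivAt_iff_tendsto_slope.1 hda.hasDerivAt
    rw [hd] at h1
    simpa [Function.comp_def] using (continuous_normSq.tendsto _).comp h1
  have hbound : Tendsto (fun u => ((f u).im - c) * (p.im - c) / (u.im * p.im)) (𝓝[≠] p)
      (𝓝 ((p.im - c) * (p.im - c) / (p.im * p.im))) := by
    have h1 : Tendsto (fun u => (f u).im) (𝓝[≠] p) (𝓝 p.im) := by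
      have := (continuous_im.tendsto _).comp (hda.continuousAt.tendsto.mono_left
        (nhdsWithin_le_nhds (s := {p}ᶜ)))
      simpa [Function.comp_def, hfp] using this
    have h2 : Tendsto im (𝓝[≠] p) (𝓝 p.im) :=
      (continuous_im.tendsto p).mono_left nhdsWithin_le_nhds
    exact ((h1.sub_const c).mul_const _).div (h2.mul_const _) (mul_pos hp hp).ne'
  have hle : ∀ᶠ u in 𝓝[≠] p,
      normSq (slope f p u) ≤ ((f u).im - c) * (p.im - c) / (u.im * p.im) := by
    filter_upwards [nhdsWithin_le_nhds hH, self_mem_nhdsWithin] with u hu hne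
    have hu0 : 0 < u.im := hu
    have hfu := hm u hu
    have h := hypGap_map_le (f := fun w => f w - c * I) (hf.sub_const _)
      (fun w hw => by simpa [mem_upperHalfPlaneSet_iff] using hm w hw) hp hu
    simp only [hypGap, sub_sub_sub_cancel_right, hfp] at h
    simp only [sub_im, mul_im, ofReal_re, I_im, mul_one, ofReal_im, I_re, mul_zero, add_zero] at h
    have h0 : 0 < normSq (u - p) := normSq_pos.2 (sub_ne_zero.2 hne)
    rw [slope_def_field, hfp, normSq_div]
    rw [div_le_div_iff₀ (mul_pos (by linarith) (by linarith)) (by positivity)] at h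
    rw [div_le_div_iff₀ h0 (by positivity)]
    linarith
  have h1 := le_of_tendsto_of_tendsto hslope hbound hle
  rw [le_div_iff₀ (by positivity)] at h1
  nlinarith

section Subord

variable {ψ₁ ψ₂ : ℂ → ℂ}

lemma analyticAt_uncurry_subordMap (hψ₁ : DifferentiableOn ℂ ψ₁ upperHalfPlaneSet)
    (hψ₂ : DifferentiableOn ℂ ψ₂ upperHalfPlaneSet)
    (hm₁ : MapsTo ψ₁ upperHalfPlaneSet upperHalfPlaneSet) {z w : ℂ} (hz : 0 ≤ z.im)
    (hw : 0 < w.im) : AnalyticAt ℂ (fun u : ℂ × ℂ => subordMap ψ₁ ψ₂ u.1 u.2) (z, w) := by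
  have hopen := UpperHalfPlane.isOpen_upperHalfPlaneSet
  have h1 : AnalyticAt ℂ ψ₁ w := hψ₁.analyticAt (hopen.mem_nhds hw)
  have h2 : AnalyticAt ℂ ψ₂ (z + ψ₁ w) :=
    hψ₂.analyticAt (hopen.mem_nhds (mapsTo_const_add hm₁ hz hw))
  have h3 : AnalyticAt ℂ (fun u : ℂ × ℂ => u.1 + ψ₁ u.2) (z, w) :=
    analyticAt_fst.add (AnalyticAt.fun_comp (f := Prod.snd) (by exact h1) analyticAt_snd)
  exact analyticAt_fst.add
    (AnalyticAt.fun_comp (f := fun u : ℂ × ℂ => u.1 + ψ₁ u.2) (by exact h2) h3)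

/-- The fixed point depends analytically on `z`, by the implicit function theorem. -/
theorem differentiableOn_of_fixed (hψ₁ : DifferentiableOn ℂ ψ₁ upperHalfPlaneSet)
    (hψ₂ : DifferentiableOn ℂ ψ₂ upperHalfPlaneSet)
    (hm₁ : MapsTo ψ₁ upperHalfPlaneSet upperHalfPlaneSet)
    (hm₂ : MapsTo ψ₂ upperHalfPlaneSet upperHalfPlaneSet) {ω : ℂ → ℂ}
    (hω : MapsTo ω upperHalfPlaneSet upperHalfPlaneSet)
    (hfix : ∀ z ∈ upperHalfPlaneSet, subordMap ψ₁ ψ₂ z (ω z) = ω z) :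
    DifferentiableOn ℂ ω upperHalfPlaneSet := by
  intro z hz
  have hz0 : 0 < z.im := hz
  have hopen := UpperHalfPlane.isOpen_upperHalfPlaneSet
  set F : ℂ × ℂ → ℂ := fun u => u.2 - subordMap ψ₁ ψ₂ u.1 u.2 with hF
  have hFa : AnalyticAt ℂ F (z, ω z) :=
    analyticAt_snd.sub (analyticAt_uncurry_subordMap hψ₁ hψ₂ hm₁ hz0.le (hω hz))
  have hFs := hFa.hasStrictFDerivAt
  set L := fderiv ℂ F (z, ω z)
  have hL : HasDerivAt (fun w => F (z, w)) ((L ∘L .inr ℂ ℂ ℂ) 1) (ω z) := by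
    have h1 : HasFDerivAt (fun w : ℂ => (z, w)) (ContinuousLinearMap.inr ℂ ℂ ℂ) (ω z) :=
      hasFDerivAt_prodMk_right z (ω z)
    exact (hFs.hasFDerivAt.comp (ω z) h1).hasDerivAt
  have hg := differentiableOn_subordMap hψ₁ hψ₂ hm₁ hz0.le
  have hL' : HasDerivAt (fun w => F (z, w)) (1 - deriv (subordMap ψ₁ ψ₂ z) (ω z)) (ω z) :=
    (hasDerivAt_id _).sub (hg.differentiableAt (hopen.mem_nhds (hω hz))).hasDerivAt
  have hne : (L ∘L .inr ℂ ℂ ℂ) 1 ≠ 0 := by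
    rw [hL.unique hL', sub_ne_zero]
    exact (deriv_ne_one_of_fixed hg hz0 (fun w hw => lt_subordMap_im hm₁ hm₂ hz0.le hw) (hω hz)
      (hfix z hz)).symm
  have hinv : (L ∘L .inr ℂ ℂ ℂ).IsInvertible :=
    ⟨ContinuousLinearEquiv.unitsEquivAut ℂ (Units.mk0 _ hne), by ext; simp⟩
  have hd := (hFs.hasStrictFDerivAt_implicitFunctionOfProdDomain hinv).differentiableAt
  refine (hd.congr_of_eventuallyEq ?_).differentiableWithinAt
  filter_upwards [hFs.eventually_apply_implicitFunctionOfProdDomain hinv,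
    (hFs.tendsto_implicitFunctionOfProdDomain hinv).eventually (hopen.mem_nhds (hω hz)),
    hopen.mem_nhds hz] with x hx1 hx2 hx3
  refine fixed_subordMap_unique hψ₁ hψ₂ hm₁ hm₂ hx3 (hω hx3) hx2 (hfix x hx3) ?_
  simp only [hF, hfix z hz, sub_self] at hx1
  exact (sub_eq_zero.1 hx1).symm

end Subord

/-! ### Cluster points at the real line -/

/-- A map into a compact Hausdorff space whose images of small sets are connected and which has
only finitely many cluster points along `l` converges along `l`. -/
theorem exists_tendsto_of_finite_mapClusterPt {X Y : Type*} [TopologicalSpace Y] [CompactSpace Y]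
    [T2Space Y] {l : Filter X} [l.NeBot] {f : X → Y}
    (hconn : ∀ s ∈ l, ∃ t ∈ l, t ⊆ s ∧ IsPreconnected (f '' t))
    (hfin : {y | MapClusterPt y l f}.Finite) : ∃ y, Tendsto f l (𝓝 y) := by
  obtain ⟨y, -, hy⟩ := isCompact_univ.exists_mapClusterPt (f := l) (u := f) (by simp)
  refine ⟨y, isCompact_univ.le_nhds_of_unique_clusterPt (by simp) fun y' _ hy' => ?_⟩
  by_contra hne
  have hsep : SeparatedNhds {y} ({y | MapClusterPt y l f} \ {y}) :=
    SeparatedNhds.of_isCompact_isCompact isCompact_singleton (hfin.sdiff).isCompact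
      disjoint_sdiff_right
  obtain ⟨U, V, hU, hV, hyU, hCV, hUV⟩ := hsep
  have hyU' : y ∈ U := hyU rfl
  have hyV' : y' ∈ V := hCV ⟨hy', hne⟩
  have hmem : f ⁻¹' (U ∪ V) ∈ l := by
    by_contra hcon
    have hNB : (l ⊓ 𝓟 (f ⁻¹' (U ∪ V))ᶜ).NeBot :=
      ⟨fun h => hcon (mem_iff_inf_principal_compl.2 h)⟩
    obtain ⟨a, ha, hcl⟩ := (hU.union hV).isClosed_compl.isCompact.exists_mapClusterPt
      (f := l ⊓ 𝓟 (f ⁻¹' (U ∪ V))ᶜ) (u := f) (by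
        rw [le_principal_iff, mem_map]
        exact mem_inf_of_right (mem_principal_self _))
    have hal : MapClusterPt a l f := hcl.mono inf_le_left
    by_cases hay : a = y
    · exact ha (Or.inl (hay ▸ hyU'))
    · exact ha (Or.inr (hCV ⟨hal, hay⟩))
  obtain ⟨t, ht, htU, htc⟩ := hconn _ hmem
  obtain ⟨a, haU, hat⟩ := ((hy.frequently (hU.mem_nhds hyU')).and_eventually ht).exists
  obtain ⟨b, hbV, hbt⟩ :=
    ((MapClusterPt.frequently hy' (hV.mem_nhds hyV')).and_eventually ht).exists
  obtain ⟨v, -, hvU, hvV⟩ := htc U V hU hV (image_subset_iff.2 htU) ⟨f a, ⟨a, hat, rfl⟩, haU⟩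
    ⟨f b, ⟨b, hbt, rfl⟩, hbV⟩
  exact disjoint_left.1 hUV hvU hvV

/-- The horodiscs at two real points `s` and `t` through a point `u` of the geodesic joining them
are tangent at `u`, so `u` is their only common point. -/
lemma eq_of_horodiscs {s t : ℝ} {u v : ℂ} (hst : s < t) (hu : 0 < u.im) (hv : 0 < v.im)
    (hgeo : (u.re - s) * (t - u.re) = u.im ^ 2) (hs : s ≤ u.re) (ht : u.re ≤ t)
    (h1 : normSq (v - s) / v.im ≤ normSq (u - s) / u.im)
    (h2 : normSq (v - t) / v.im ≤ normSq (u - t) / u.im) : v = u := by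
  rw [div_le_div_iff₀ hv hu] at h1 h2
  simp only [normSq_apply, sub_re, sub_im, ofReal_re, ofReal_im, sub_zero] at h1 h2
  -- the average of the two inequalities with weights that balance at `u.re`
  have key : u.im * (t - s) * ((v.re - u.re) ^ 2 + (v.im - u.im) ^ 2) ≤ 0 := by
    have h3 := mul_le_mul_of_nonneg_left h1 (sub_nonneg.2 ht)
    have h4 := mul_le_mul_of_nonneg_left h2 (sub_nonneg.2 hs)
    have e : u.im ^ 2 * ((t - s) * u.im) = (u.re - s) * (t - u.re) * ((t - s) * u.im) := by
      rw [hgeo]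
    have e' : u.im ^ 2 * ((t - s) * v.im) = (u.re - s) * (t - u.re) * ((t - s) * v.im) := by
      rw [hgeo]
    linarith
  have h5 : (v.re - u.re) ^ 2 + (v.im - u.im) ^ 2 ≤ 0 :=
    nonpos_of_mul_nonpos_right key (mul_pos hu (sub_pos.2 hst))
  apply Complex.ext
  · nlinarith [sq_nonneg (v.re - u.re), sq_nonneg (v.im - u.im)]
  · nlinarith [sq_nonneg (v.re - u.re), sq_nonneg (v.im - u.im)]

/-- An analytic self-map of the half-plane that preserves the horodiscs at two distinct real
points is the identity, because it fixes the geodesic joining them. -/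
theorem eqOn_id_of_two_horodiscs {f : ℂ → ℂ} (hf : DifferentiableOn ℂ f upperHalfPlaneSet)
    (hm : MapsTo f upperHalfPlaneSet upperHalfPlaneSet) {s t : ℝ} (hst : s < t)
    (h1 : ∀ u ∈ upperHalfPlaneSet, normSq (f u - s) / (f u).im ≤ normSq (u - s) / u.im)
    (h2 : ∀ u ∈ upperHalfPlaneSet, normSq (f u - t) / (f u).im ≤ normSq (u - t) / u.im) :
    EqOn f id upperHalfPlaneSet := by
  set r := (t - s) / 2 with hr
  have hr0 : 0 < r := by rw [hr]; linarith
  have hfix : ∀ a b : ℝ, 0 < b → a ^ 2 + b ^ 2 = 1 →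
      f ⟨s + r + r * a, r * b⟩ = ⟨s + r + r * a, r * b⟩ := by
    intro a b hb hab
    have hu : (0 : ℝ) < (⟨s + r + r * a, r * b⟩ : ℂ).im := mul_pos hr0 hb
    have ha : -1 ≤ a ∧ a ≤ 1 := abs_le.1 (abs_le_one_iff_mul_self_le_one.2 (by nlinarith))
    have ht : t = s + 2 * r := by rw [hr]; ring
    refine eq_of_horodiscs hst hu (hm hu) ?_ ?_ ?_ (h1 _ hu) (h2 _ hu)
    · simp only [ht]
      linear_combination (-r ^ 2) * hab
    · change s ≤ s + r + r * a
      nlinarith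
    · change s + r + r * a ≤ t
      nlinarith
  refine eqOn_id_of_two_fixed hf hm (p := ⟨s + r + r * 0, r * 1⟩)
    (u := ⟨s + r + r * (3 / 5), r * (4 / 5)⟩) (by simpa using hr0) ?_ ?_
    (hfix 0 1 one_pos (by norm_num)) (hfix _ _ (by norm_num) (by norm_num))
  · change 0 < r * (4 / 5)
    positivity
  · intro h
    have := congrArg im h
    simp only at this
    linarith

section Subord

variable {ψ₁ ψ₂ ω : ℂ → ℂ} {x : ℝ} {a : ℂ} {l : Filter ℂ}

lemma subordMap_eq_of_tendsto (hψ₁ : DifferentiableOn ℂ ψ₁ upperHalfPlaneSet)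
    (hψ₂ : DifferentiableOn ℂ ψ₂ upperHalfPlaneSet)
    (hm₁ : MapsTo ψ₁ upperHalfPlaneSet upperHalfPlaneSet)
    (hfix : ∀ z ∈ upperHalfPlaneSet, subordMap ψ₁ ψ₂ z (ω z) = ω z) [l.NeBot]
    (hl : l ≤ 𝓝[upperHalfPlaneSet] (x : ℂ)) (hlim : Tendsto ω l (𝓝 a)) (ha : 0 < a.im) :
    subordMap ψ₁ ψ₂ x a = a := by
  have h1 := (analyticAt_uncurry_subordMap hψ₁ hψ₂ hm₁ (z := x) (by simp) ha).continuousAt.tendsto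
  have h2 : Tendsto (fun z => (z, ω z)) l (𝓝 ((x : ℂ), a)) :=
    (tendsto_id.mono_left (hl.trans nhdsWithin_le_nhds)).prodMk_nhds hlim
  refine tendsto_nhds_unique ((h1.comp h2).congr' ?_) hlim
  filter_upwards [hl self_mem_nhdsWithin] with z hz using hfix z hz

/-- **Wolff's lemma** in the limit: a real cluster value `a` of the fixed points of
`subordMap ψ₁ ψ₂ z` as `z → x` makes `subordMap ψ₁ ψ₂ x` preserve the horodiscs at `a`. -/
theorem horodisc_of_tendsto (hψ₁ : DifferentiableOn ℂ ψ₁ upperHalfPlaneSet)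
    (hψ₂ : DifferentiableOn ℂ ψ₂ upperHalfPlaneSet)
    (hm₁ : MapsTo ψ₁ upperHalfPlaneSet upperHalfPlaneSet)
    (hm₂ : MapsTo ψ₂ upperHalfPlaneSet upperHalfPlaneSet)
    (hω : MapsTo ω upperHalfPlaneSet upperHalfPlaneSet)
    (hfix : ∀ z ∈ upperHalfPlaneSet, subordMap ψ₁ ψ₂ z (ω z) = ω z) [l.NeBot]
    (hl : l ≤ 𝓝[upperHalfPlaneSet] (x : ℂ)) (hlim : Tendsto ω l (𝓝 a)) {u : ℂ}
    (hu : u ∈ upperHalfPlaneSet) :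
    normSq (subordMap ψ₁ ψ₂ x u - a) / (subordMap ψ₁ ψ₂ x u).im ≤ normSq (u - a) / u.im := by
  have hu0 : 0 < u.im := hu
  have hfu : 0 < (subordMap ψ₁ ψ₂ x u).im := mapsTo_subordMap hm₁ hm₂ (by simp) hu
  have h1 := (analyticAt_uncurry_subordMap hψ₁ hψ₂ hm₁ (z := x) (by simp) hu).continuousAt.tendsto
  have h2 : Tendsto (fun z => (z, u)) l (𝓝 ((x : ℂ), u)) :=
    (tendsto_id.mono_left (hl.trans nhdsWithin_le_nhds)).prodMk_nhds tendsto_const_nhds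
  have h3 : Tendsto (fun z => subordMap ψ₁ ψ₂ z u) l (𝓝 (subordMap ψ₁ ψ₂ x u)) := h1.comp h2
  refine le_of_tendsto_of_tendsto
    (((continuous_normSq.tendsto _).comp (h3.sub hlim)).div ((continuous_im.tendsto _).comp h3)
      hfu.ne')
    (((continuous_normSq.tendsto _).comp (hlim.const_sub u)).div_const u.im) ?_
  filter_upwards [hl self_mem_nhdsWithin] with z hz
  have hz0 : 0 < z.im := hz
  have h4 := hypGap_map_le (differentiableOn_subordMap hψ₁ hψ₂ hm₁ hz0.le)
    (mapsTo_subordMap hm₁ hm₂ hz0.le) (hω hz) hu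
  have hωz : 0 < (ω z).im := hω hz
  rw [hfix z hz, hypGap, hypGap, ← div_div, ← div_div, div_le_div_iff_of_pos_right hωz] at h4
  exact h4

/-- If `subordMap ψ₁ ψ₂ x` is the identity, then `x + ψ₁` is a Möbius transformation, and the
fixed-point equation at `z` becomes a quadratic equation, degenerating to `(A w + B)² = K` at
`z = x`. -/
theorem exists_quadratic_of_eqOn_id (hψ₁ : DifferentiableOn ℂ ψ₁ upperHalfPlaneSet)
    (hψ₂ : DifferentiableOn ℂ ψ₂ upperHalfPlaneSet)
    (hm₁ : MapsTo ψ₁ upperHalfPlaneSet upperHalfPlaneSet)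
    (hm₂ : MapsTo ψ₂ upperHalfPlaneSet upperHalfPlaneSet)
    (hid : EqOn (subordMap ψ₁ ψ₂ x) id upperHalfPlaneSet) :
    ∃ A B K : ℂ, A ≠ 0 ∧ ∀ z ∈ upperHalfPlaneSet, ∀ w ∈ upperHalfPlaneSet,
      subordMap ψ₁ ψ₂ z w = w → (A * w + B) * (A * (w - (z - x)) + B) = K := by
  set φ₁ : ℂ → ℂ := fun w => x + ψ₁ w with hφ₁
  set φ₂ : ℂ → ℂ := fun w => x + ψ₂ w with hφ₂
  have hd₁ : DifferentiableOn ℂ φ₁ upperHalfPlaneSet := hψ₁.const_add _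
  have hd₂ : DifferentiableOn ℂ φ₂ upperHalfPlaneSet := hψ₂.const_add _
  have hM₁ : MapsTo φ₁ upperHalfPlaneSet upperHalfPlaneSet := mapsTo_const_add hm₁ (by simp)
  have hM₂ : MapsTo φ₂ upperHalfPlaneSet upperHalfPlaneSet := mapsTo_const_add hm₂ (by simp)
  have hinv : ∀ w ∈ upperHalfPlaneSet, φ₂ (φ₁ w) = w := hid
  have hI : I ∈ upperHalfPlaneSet := by simp
  have h2I : 2 * I ∈ upperHalfPlaneSet := by simp
  have hne : 2 * I ≠ I := by
    intro h
    simpa using congrArg im h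
  have hgap₂ : hypGap (2 * I) I ≤ hypGap (φ₁ (2 * I)) (φ₁ I) := by
    have := hypGap_map_le hd₂ hM₂ (hM₁ hI) (hM₁ h2I)
    rwa [hinv _ hI, hinv _ h2I] at this
  have hinj : InjOn φ₂ upperHalfPlaneSet := by
    obtain ⟨κ, hκ0, -, hκ⟩ := exists_cayley_map_eq hd₂ hM₂ (hM₁ hI) (hM₁ h2I)
      (fun h => hne (by rw [← hinv _ h2I, h, hinv _ hI])) (by
        rw [hinv _ hI, hinv _ h2I]
        exact hypGap_map_le hd₁ hM₁ hI h2I)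
    intro u hu v hv huv
    have h := hκ u hu
    rw [huv, hκ v hv] at h
    exact (cayley_injOn (hM₁ hI) hv hu (mul_left_cancel₀ hκ0 h)).symm
  obtain ⟨κ, hκ0, -, hκ⟩ := exists_cayley_map_eq hd₁ hM₁ hI h2I hne hgap₂
  set b := φ₁ I with hb
  have hb0 : 0 < b.im := hM₁ hI
  have hmob : ∀ v ∈ upperHalfPlaneSet, (φ₁ v - b) * (v + I) = κ * (v - I) * (φ₁ v - conj b) := by
    intro v hv
    have h := hκ v hv
    have h1 : φ₁ v - conj b ≠ 0 := sub_conj_ne_zero (hM₁ hv) hb0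
    have h2 : v - conj I ≠ 0 := sub_conj_ne_zero hv hI
    unfold cayley at h
    rw [div_eq_iff h1] at h
    field_simp at h
    rw [conj_I, sub_neg_eq_add] at h
    linear_combination h
  have hquad : ∀ z ∈ upperHalfPlaneSet, ∀ w ∈ upperHalfPlaneSet, subordMap ψ₁ ψ₂ z w = w →
      ((1 - κ) * w + (1 + κ) * I) * ((1 - κ) * (w - (z - x)) + (1 + κ) * I) =
        2 * I * κ * (conj b - b) := by
    intro z hz w hw hfix
    have hz0 : 0 < z.im := hz
    have hwz : w - (z - x) ∈ upperHalfPlaneSet := by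
      have := lt_subordMap_im hm₁ hm₂ hz0.le hw
      rw [hfix] at this
      simpa [mem_upperHalfPlaneSet_iff] using this
    have hw' : z + ψ₁ w ∈ upperHalfPlaneSet := mapsTo_const_add hm₁ hz0.le hw
    -- `x + ψ₂` takes the same value `w - (z - x)` at both points
    have hshift : φ₁ (w - (z - x)) = z + ψ₁ w := by
      refine hinj (hM₁ hwz) hw' ?_
      rw [hinv _ hwz]
      have : z + ψ₂ (z + ψ₁ w) = w := hfix
      simp only [hφ₂]
      linear_combination -this
    have e1 := hmob w hw
    have e2 := hmob _ hwz
    rw [hshift] at e2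
    have hh : z - x ≠ 0 := by
      intro h0
      have := congrArg im h0
      simp at this
      exact hz0.ne' this
    refine mul_left_cancel₀ hh ?_
    simp only [hφ₁] at e1
    linear_combination ((1 - κ) * w + (1 + κ) * I) * e2 -
      ((1 - κ) * (w - (z - x)) + (1 + κ) * I) * e1
  by_cases hκ1 : κ = 1
  · -- for `κ = 1` the equation reads `-4 = 4 Im b`, so there is no fixed point at all
    refine ⟨1, 0, 0, one_ne_zero, fun z hz w hw hfix => ?_⟩
    exfalso
    have h := congrArg re (hquad z hz w hw hfix)
    rw [hκ1] at h
    simp at h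
    linarith
  · exact ⟨1 - κ, (1 + κ) * I, _, sub_ne_zero.2 (Ne.symm hκ1), hquad⟩

lemma finite_setOf_affine_sq_eq {A : ℂ} (B K : ℂ) (hA : A ≠ 0) :
    {w : ℂ | (A * w + B) ^ 2 = K}.Finite := by
  obtain ⟨s, hs⟩ := IsAlgClosed.exists_pow_nat_eq K two_pos
  refine (Set.toFinite {(s - B) / A, (-s - B) / A}).subset fun w hw => ?_
  rw [mem_ofPred_eq, ← hs, sq_eq_sq_iff_eq_or_eq_neg] at hw
  refine hw.imp (fun h => ?_) fun h => ?_
  · rw [eq_div_iff hA]; linear_combination h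
  · rw [mem_singleton_iff, eq_div_iff hA]; linear_combination h

/-- The function `ω` of fixed points has finitely many finite cluster values at each real
point. -/
theorem finite_mapClusterPt_of_fixed (hψ₁ : DifferentiableOn ℂ ψ₁ upperHalfPlaneSet)
    (hψ₂ : DifferentiableOn ℂ ψ₂ upperHalfPlaneSet)
    (hm₁ : MapsTo ψ₁ upperHalfPlaneSet upperHalfPlaneSet)
    (hm₂ : MapsTo ψ₂ upperHalfPlaneSet upperHalfPlaneSet)
    (hω : MapsTo ω upperHalfPlaneSet upperHalfPlaneSet)
    (hfix : ∀ z ∈ upperHalfPlaneSet, subordMap ψ₁ ψ₂ z (ω z) = ω z) (x : ℝ) :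
    {a | MapClusterPt a (𝓝[upperHalfPlaneSet] (x : ℂ)) ω}.Finite := by
  have hx : (0 : ℝ) ≤ (x : ℂ).im := by simp
  by_cases hid : EqOn (subordMap ψ₁ ψ₂ x) id upperHalfPlaneSet
  · obtain ⟨A, B, K, hA, hK⟩ := exists_quadratic_of_eqOn_id hψ₁ hψ₂ hm₁ hm₂ hid
    refine (finite_setOf_affine_sq_eq B K hA).subset fun a ha => ?_
    obtain ⟨U, hU, hlim⟩ := mapClusterPt_iff_ultrafilter.1 ha
    have h1 : Tendsto (fun z : ℂ => z) U (𝓝 (x : ℂ)) :=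
      tendsto_id.mono_left (hU.trans nhdsWithin_le_nhds)
    have h2 : Tendsto (fun z => (A * ω z + B) * (A * (ω z - (z - x)) + B)) U
        (𝓝 ((A * a + B) * (A * (a - (x - x)) + B))) :=
      ((hlim.const_mul A).add_const B).mul
        (((hlim.sub (h1.sub_const _)).const_mul A).add_const B)
    have h3 : (fun z => (A * ω z + B) * (A * (ω z - (z - x)) + B)) =ᶠ[(U : Filter ℂ)]
        fun _ => K := by
      filter_upwards [hU self_mem_nhdsWithin] with z hz using hK z hz _ (hω hz) (hfix z hz)
    have h4 := tendsto_nhds_unique (h2.congr' h3) tendsto_const_nhds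
    rw [sub_self, sub_zero] at h4
    rw [mem_ofPred_eq, sq]
    exact h4.symm ▸ rfl
  have hd := differentiableOn_subordMap hψ₁ hψ₂ hm₁ hx
  have hM := mapsTo_subordMap hm₁ hm₂ hx
  have hint : {a | MapClusterPt a (𝓝[upperHalfPlaneSet] (x : ℂ)) ω ∧ 0 < a.im}.Subsingleton := by
    rintro a ⟨ha, ha0⟩ b ⟨hb, hb0⟩
    by_contra hne
    obtain ⟨U, hU, hlimU⟩ := mapClusterPt_iff_ultrafilter.1 ha
    obtain ⟨V, hV, hlimV⟩ := mapClusterPt_iff_ultrafilter.1 hb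
    exact hid (eqOn_id_of_two_fixed hd hM hb0 ha0 hne
      (subordMap_eq_of_tendsto hψ₁ hψ₂ hm₁ hfix hV hlimV hb0)
      (subordMap_eq_of_tendsto hψ₁ hψ₂ hm₁ hfix hU hlimU ha0))
  have hreal : {s : ℝ | MapClusterPt (s : ℂ) (𝓝[upperHalfPlaneSet] (x : ℂ)) ω}.Subsingleton := by
    refine fun s hs t ht => ?_
    by_contra hne
    wlog hst : s < t generalizing s t
    · exact this t ht s hs (Ne.symm hne) (lt_of_le_of_ne (not_lt.1 hst) (Ne.symm hne))
    obtain ⟨U, hU, hlimU⟩ := mapClusterPt_iff_ultrafilter.1 hs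
    obtain ⟨V, hV, hlimV⟩ := mapClusterPt_iff_ultrafilter.1 ht
    exact hid (eqOn_id_of_two_horodiscs hd hM hst
      (fun u hu => horodisc_of_tendsto hψ₁ hψ₂ hm₁ hm₂ hω hfix hU hlimU hu)
      (fun u hu => horodisc_of_tendsto hψ₁ hψ₂ hm₁ hm₂ hω hfix hV hlimV hu))
  refine (hint.finite.union (hreal.finite.image ((↑) : ℝ → ℂ))).subset fun a ha => ?_
  obtain ⟨U, hU, hlim⟩ := mapClusterPt_iff_ultrafilter.1 ha
  have h0 : 0 ≤ a.im := by
    refine ge_of_tendsto ((continuous_im.tendsto _).comp hlim) ?_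
    filter_upwards [hU self_mem_nhdsWithin] with z hz using (hω hz).le
  rcases h0.lt_or_eq with h | h
  · exact Or.inl ⟨ha, h⟩
  · have hre : (a.re : ℂ) = a := Complex.ext rfl (by simpa using h)
    exact Or.inr ⟨a.re, by rw [mem_ofPred_eq, hre]; exact ha, hre⟩

/-- The function `ω` of fixed points has a limit in the Riemann sphere at each real point. -/
theorem exists_tendsto_of_fixed (hψ₁ : DifferentiableOn ℂ ψ₁ upperHalfPlaneSet)
    (hψ₂ : DifferentiableOn ℂ ψ₂ upperHalfPlaneSet)
    (hm₁ : MapsTo ψ₁ upperHalfPlaneSet upperHalfPlaneSet)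
    (hm₂ : MapsTo ψ₂ upperHalfPlaneSet upperHalfPlaneSet)
    (hω : MapsTo ω upperHalfPlaneSet upperHalfPlaneSet)
    (hfix : ∀ z ∈ upperHalfPlaneSet, subordMap ψ₁ ψ₂ z (ω z) = ω z) (x : ℝ) :
    ∃ y, Tendsto (fun z => (ω z : OnePoint ℂ)) (𝓝[upperHalfPlaneSet] (x : ℂ)) (𝓝 y) := by
  have hcont : ContinuousOn (fun z => (ω z : OnePoint ℂ)) upperHalfPlaneSet :=
    OnePoint.continuous_coe.comp_continuousOn
      (differentiableOn_of_fixed hψ₁ hψ₂ hm₁ hm₂ hω hfix).continuousOn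
  have hconv : Convex ℝ upperHalfPlaneSet := convex_halfSpace_im_gt 0
  have hNB : (𝓝[upperHalfPlaneSet] (x : ℂ)).NeBot := by
    rw [← mem_closure_iff_nhdsWithin_neBot]
    have : closure upperHalfPlaneSet = {z : ℂ | 0 ≤ z.im} := closure_setOfPred_lt_im 0
    rw [this]
    simp
  refine exists_tendsto_of_finite_mapClusterPt (fun s hs => ?_) ?_
  · obtain ⟨ε, hε, hsub⟩ := Metric.mem_nhdsWithin_iff.1 hs
    refine ⟨_, inter_mem (mem_nhdsWithin_of_mem_nhds (Metric.ball_mem_nhds _ hε))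
      self_mem_nhdsWithin, hsub, ?_⟩
    exact ((convex_ball _ _).inter hconv).isPreconnected.image _ (hcont.mono inter_subset_right)
  · refine (((finite_mapClusterPt_of_fixed hψ₁ hψ₂ hm₁ hm₂ hω hfix x).image
      ((↑) : ℂ → OnePoint ℂ)).insert OnePoint.infty).subset fun y hy => ?_
    induction y using OnePoint.rec with
    | infty => exact Or.inl rfl
    | coe a =>
      refine Or.inr ⟨a, ?_, rfl⟩
      obtain ⟨U, hU, hlim⟩ := mapClusterPt_iff_ultrafilter.1 hy
      exact mapClusterPt_iff_ultrafilter.2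
        ⟨U, hU, OnePoint.isOpenEmbedding_coe.tendsto_nhds_iff.2 hlim⟩

/-- One subordination function together with its continuous boundary extension. -/
theorem exists_subordination (hψ₁ : DifferentiableOn ℂ ψ₁ upperHalfPlaneSet)
    (hψ₂ : DifferentiableOn ℂ ψ₂ upperHalfPlaneSet)
    (hm₁ : MapsTo ψ₁ upperHalfPlaneSet upperHalfPlaneSet)
    (hm₂ : MapsTo ψ₂ upperHalfPlaneSet upperHalfPlaneSet)
    (hlim₁ : Tendsto (fun y : ℝ => ψ₁ ((y : ℂ) * I) / ((y : ℂ) * I)) atTop (𝓝 0)) :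
    ∃ (Ω : ℂ → OnePoint ℂ) (f : ℂ → ℂ), MapsTo Ω closedHalfPlane sphereHalfPlane ∧
      ContinuousOn Ω closedHalfPlane ∧ (∀ z ∈ upperHalfPlaneSet, Ω z = (f z : OnePoint ℂ)) ∧
      AnalyticOnNhd ℂ f upperHalfPlaneSet ∧ MapsTo f upperHalfPlaneSet upperHalfPlaneSet ∧
      ∀ z ∈ upperHalfPlaneSet, subordMap ψ₁ ψ₂ z (f z) = f z := by
  have hex : ∀ z : ℂ, ∃ w : ℂ, z ∈ upperHalfPlaneSet →
      w ∈ upperHalfPlaneSet ∧ subordMap ψ₁ ψ₂ z w = w := fun z => by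
    by_cases hz : z ∈ upperHalfPlaneSet
    · obtain ⟨w, hw, h⟩ := exists_fixed_subordMap hψ₁ hψ₂ hm₁ hm₂ hlim₁ hz
      exact ⟨w, fun _ => ⟨hw, h⟩⟩
    · exact ⟨0, fun h => absurd h hz⟩
  choose f hf using hex
  have hmaps : MapsTo f upperHalfPlaneSet upperHalfPlaneSet := fun z hz => (hf z hz).1
  have hfix : ∀ z ∈ upperHalfPlaneSet, subordMap ψ₁ ψ₂ z (f z) = f z := fun z hz => (hf z hz).2
  have hdiff := differentiableOn_of_fixed hψ₁ hψ₂ hm₁ hm₂ hmaps hfix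
  have hcont : ContinuousOn (fun z => (f z : OnePoint ℂ)) upperHalfPlaneSet :=
    OnePoint.continuous_coe.comp_continuousOn hdiff.continuousOn
  have hclosure : closure upperHalfPlaneSet = closedHalfPlane := closure_setOfPred_lt_im 0
  have hext := extendFrom_extends hcont
  have hΩ : ContinuousOn (extendFrom upperHalfPlaneSet fun z => (f z : OnePoint ℂ))
      closedHalfPlane := by
    refine continuousOn_extendFrom hclosure.ge fun z hz => ?_
    rcases (show 0 ≤ z.im from hz).lt_or_eq with h | h
    · exact ⟨_, hcont z h⟩
    · have hre : (z.re : ℂ) = z := Complex.ext rfl (by simpa using h)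
      rw [← hre]
      exact exists_tendsto_of_fixed hψ₁ hψ₂ hm₁ hm₂ hmaps hfix z.re
  refine ⟨_, f, ?_, hΩ, hext, hdiff.analyticOnNhd UpperHalfPlane.isOpen_upperHalfPlaneSet, hmaps,
    hfix⟩
  have hclosed : IsClosed sphereHalfPlane := by
    have h1 : sphereHalfPlane =
        ((fun w : ℂ => (w : OnePoint ℂ)) '' {w : ℂ | w.im < 0})ᶜ := by
      ext y
      induction y using OnePoint.rec with
      | infty => simp [sphereHalfPlane]
      | coe a => simp [sphereHalfPlane, closedHalfPlane]
    rw [h1, isClosed_compl_iff]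
    exact OnePoint.isOpenEmbedding_coe.isOpenMap _ (isOpen_lt continuous_im continuous_const)
  rw [← hclosure]
  rw [← hclosure] at hΩ
  have h2 : MapsTo (extendFrom upperHalfPlaneSet fun z => (f z : OnePoint ℂ)) upperHalfPlaneSet
      sphereHalfPlane := fun z hz => by
    rw [hext z hz]
    exact Or.inr ⟨f z, le_of_lt (b := (f z).im) (hmaps hz), rfl⟩
  have h3 := h2.closure_of_continuousOn hΩ
  rwa [hclosed.closure_eq] at h3

end Subord

/-! ### The pair of subordination functions -/

theorem corollary3p5 (ψ₁ ψ₂ : ℂ → ℂ)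
    (hψ₁ : AnalyticOnNhd ℂ ψ₁ upperHalfPlaneSet) (hψ₂ : AnalyticOnNhd ℂ ψ₂ upperHalfPlaneSet)
    (hm₁ : MapsTo ψ₁ upperHalfPlaneSet upperHalfPlaneSet)
    (hm₂ : MapsTo ψ₂ upperHalfPlaneSet upperHalfPlaneSet)
    (hlim₁ : Tendsto (fun y : ℝ => ψ₁ ((y : ℂ) * I) / ((y : ℂ) * I)) atTop (𝓝 0))
    (hlim₂ : Tendsto (fun y : ℝ => ψ₂ ((y : ℂ) * I) / ((y : ℂ) * I)) atTop (𝓝 0)) :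
    ∃ ω₁ ω₂ : ℂ → OnePoint ℂ,
      MapsTo ω₁ closedHalfPlane sphereHalfPlane ∧ MapsTo ω₂ closedHalfPlane sphereHalfPlane ∧
      ContinuousOn ω₁ closedHalfPlane ∧ ContinuousOn ω₂ closedHalfPlane ∧
      ∃ f₁ f₂ : ℂ → ℂ,
        (∀ z ∈ upperHalfPlaneSet, ω₁ z = (f₁ z : OnePoint ℂ)) ∧
        (∀ z ∈ upperHalfPlaneSet, ω₂ z = (f₂ z : OnePoint ℂ)) ∧
        AnalyticOnNhd ℂ f₁ upperHalfPlaneSet ∧ AnalyticOnNhd ℂ f₂ upperHalfPlaneSet ∧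
        MapsTo f₁ upperHalfPlaneSet upperHalfPlaneSet ∧ MapsTo f₂ upperHalfPlaneSet upperHalfPlaneSet ∧
        ∀ z ∈ upperHalfPlaneSet,
          f₁ z + ψ₁ (f₁ z) = f₂ z + ψ₂ (f₂ z) ∧ f₂ z + ψ₂ (f₂ z) = f₁ z + f₂ z - z := by
  have hd₁ := hψ₁.differentiableOn
  have hd₂ := hψ₂.differentiableOn
  obtain ⟨ω₁, f₁, hω₁, hc₁, he₁, ha₁, hf₁, hfix₁⟩ := exists_subordination hd₁ hd₂ hm₁ hm₂ hlim₁
  obtain ⟨ω₂, f₂, hω₂, hc₂, he₂, ha₂, hf₂, hfix₂⟩ := exists_subordination hd₂ hd₁ hm₂ hm₁ hlim₂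
  refine ⟨ω₁, ω₂, hω₁, hω₂, hc₁, hc₂, f₁, f₂, he₁, he₂, ha₁, ha₂, hf₁, hf₂, fun z hz => ?_⟩
  have hz0 : 0 < z.im := hz
  have h1 : z + ψ₂ (z + ψ₁ (f₁ z)) = f₁ z := hfix₁ z hz
  -- `z + ψ₁ (f₁ z)` is a fixed point of the map with `ψ₁` and `ψ₂` exchanged
  have h2 : f₂ z = z + ψ₁ (f₁ z) :=
    fixed_subordMap_unique hd₂ hd₁ hm₂ hm₁ hz (hf₂ hz) (mapsTo_const_add hm₁ hz0.le (hf₁ hz))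
      (hfix₂ z hz) (by rw [subordMap, h1])
  rw [← h2] at h1
  constructor
  · linear_combination -h2 - h1
  · linear_combination h1
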